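/- Let $n\ge 1$, let $f:\mathbb R\to\mathbb R$ be an arbitrary function (no regularity is assumed), and let $u_1,u_2\in C^\infty([0,1))$ be real-valued with $u_i^{(n)}(t)=f(u_i(t))$ for all $t\in[0,1)$, $i=1,2$ (derivatives at $0$ are one-sided). Suppose that for some integers $m,l\ge n$ and real numbers $a,b$, $$u_1(0)=u_1'(0)=\cdots=u_1^{(m-1)}(0)=0,\quad u_1^{(m)}(0)=a\neq 0,$$ $$u_2(0)=u_2'(0)=\cdots=u_2^{(l-1)}(0)=0,\quad u_2^{(l)}(0)=b\neq 0,$$ and, in the case that both $m>n$ and $l>n$, that $a$ and $b$ have the same sign (that is, for small $t>0$ the values of $u_1$ and $u_2$ lie on the same side of $0$). Then $m=l$, $a=b$, and there is $\delta\in(0,1]$ such that $u_1(t)=u_2(t)$ for all $t\in[0,\delta)$. -/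

import Mathlib

open scoped ContDiff

/-- `u` is a smooth solution on `[0, 1)` of the autonomous equation `u⁽ⁿ⁾ = f(u)`:
`u ∈ C^∞([0, 1))` (one-sided derivatives at the endpoint `0`) and
`u⁽ⁿ⁾(t) = f (u t)` for every `t ∈ [0, 1)`. No regularity of `f` is required. Only the values
of `u` on `[0, 1)` matter. -/
structure IsSmoothSolution (n : ℕ) (f u : ℝ → ℝ) : Prop where
  smooth : ContDiffOn ℝ ∞ u (Set.Ico 0 1)
  eqn : ∀ t ∈ Set.Ico (0 : ℝ) 1, iteratedDerivWithin n u (Set.Ico 0 1) t = f (u t)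

/-- The initial condition `u(0) = u'(0) = ⋯ = u⁽ᵐ⁻¹⁾(0) = 0` and `u⁽ᵐ⁾(0) = a ≠ 0`
for a function on `[0, 1)`. -/
structure VanishesToOrder (u : ℝ → ℝ) (m : ℕ) (a : ℝ) : Prop where
  lower : ∀ k < m, iteratedDerivWithin k u (Set.Ico 0 1) 0 = 0
  leading : iteratedDerivWithin m u (Set.Ico 0 1) 0 = a
  ne_zero : a ≠ 0

/-!
Two solutions that leave `0` on the same side sweep out the same values, so `u₁ (σ t) = u₂ t` for
a change of time `σ t → 0⁺` (`exists_time_change`, by the intermediate value theorem). The equation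
turns equality of values into equality of `n`-th derivatives at the times `σ t` and `t`, whatever
`f` is. By Taylor's formula `tⁿ u⁽ⁿ⁾ / u` tends to `m (m - 1) ⋯ (m - n + 1)` for a function vanishing
to order exactly `m`; comparing the two solutions along `σ` forces the orders and the leading
coefficients to agree and `σ t / t → 1` (`leading_term_eq_of_time_change`).

For the difference `w = u₁ - u₂`, Cauchy's mean value theorem on the interval between `t` and `σ t`
gives `w⁽ⁿ⁾(t) = w(t) · u₁⁽ⁿ⁺¹⁾(ξ) / u₁'(ξ)`, and since `ξ / t → 1` the factor is asymptotic to
`(m - 1)(m - 2) ⋯ (m - n) t⁻ⁿ`. Hence `tⁿ |w⁽ⁿ⁾| ≤ K |w|` for any larger constant `K`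
(`eventually_pow_mul_abs_iteratedDerivWithin_sub_le`). Such a `K` can be taken below
`m (m - 1) ⋯ (m - n + 1)`, and then integrating `n` times improves a bound `|w| ≤ M tᵐ` by a fixed
factor less than `1`, so `w` vanishes near `0` (`eq_zero_of_abs_iteratedDerivWithin_le`).
-/

section

open Set Filter Topology Asymptotics Nat

/-! ### Iterated derivatives on `[0, 1)` -/

theorem iteratedDerivWithin_iteratedDerivWithin (j k : ℕ) (u : ℝ → ℝ) (s : Set ℝ) :
    iteratedDerivWithin j (iteratedDerivWithin k u s) s = iteratedDerivWithin (k + j) u s := by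
  induction j with
  | zero => simp
  | succ j ih => rw [iteratedDerivWithin_succ, ih, ← add_assoc, iteratedDerivWithin_succ]

theorem ContDiffOn.iteratedDerivWithin_infty {u : ℝ → ℝ} {s : Set ℝ} (hs : UniqueDiffOn ℝ s)
    (hu : ContDiffOn ℝ ∞ u s) (k : ℕ) : ContDiffOn ℝ ∞ (iteratedDerivWithin k u s) s := by
  refine contDiffOn_of_differentiableOn_deriv fun j _ => ?_
  rw [iteratedDerivWithin_iteratedDerivWithin]
  exact hu.differentiableOn_iteratedDerivWithin (mod_cast ENat.natCast_lt_top _) hs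

theorem ContDiffOn.hasDerivWithinAt_iteratedDerivWithin {u : ℝ → ℝ} {s : Set ℝ}
    (hs : UniqueDiffOn ℝ s) (hu : ContDiffOn ℝ ∞ u s) (k : ℕ) {t : ℝ} (ht : t ∈ s) :
    HasDerivWithinAt (iteratedDerivWithin k u s) (iteratedDerivWithin (k + 1) u s t) s t := by
  rw [iteratedDerivWithin_succ]
  exact (hu.differentiableOn_iteratedDerivWithin (mod_cast ENat.natCast_lt_top _) hs t
    ht).hasDerivWithinAt

theorem tendsto_pow_nhdsGT_zero {k : ℕ} (hk : k ≠ 0) :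
    Tendsto (fun t : ℝ => t ^ k) (𝓝[>] 0) (𝓝 0) := by
  have := (continuous_pow (M := ℝ) k).tendsto 0
  rw [zero_pow hk] at this
  exact this.mono_left nhdsWithin_le_nhds

/-- Leading-order behaviour of all derivatives. The orders `k > m` are included, where
`m.descFactorial k = 0`. -/
theorem VanishesToOrder.tendsto_pow_mul_iteratedDerivWithin {u : ℝ → ℝ} {m : ℕ} {a : ℝ}
    (h : VanishesToOrder u m a) (hu : ContDiffOn ℝ ∞ u (Ico 0 1)) (k : ℕ) :
    Tendsto (fun t => t ^ k * iteratedDerivWithin k u (Ico 0 1) t / t ^ m) (𝓝[>] 0)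
      (𝓝 (a * m.descFactorial k / m !)) := by
  have hs : UniqueDiffOn ℝ (Ico (0 : ℝ) 1) := uniqueDiffOn_Ico 0 1
  have h0 : (0 : ℝ) ∈ Ico (0 : ℝ) 1 := by simp
  have hle : 𝓝[>] (0 : ℝ) ≤ 𝓝[Ico 0 1] 0 :=
    nhdsWithin_le_iff.2 (mem_of_superset (Ioo_mem_nhdsGT one_pos) Ioo_subset_Ico_self)
  have hk := hu.iteratedDerivWithin_infty hs k
  rcases le_or_gt k m with hkm | hkm
  · obtain ⟨p, rfl⟩ := Nat.exists_eq_add_of_le hkm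
    have hT := (taylor_isLittleO (n := p) (convex_Ico (0 : ℝ) 1) h0
      (hk.of_le (mod_cast le_top))).mono hle
    have hsum : ∀ t : ℝ, taylorWithinEval (iteratedDerivWithin k u (Ico 0 1)) p (Ico 0 1) 0 t
        = a / p ! * t ^ p := by
      intro t
      rw [taylor_within_apply, Finset.sum_range_succ, Finset.sum_eq_zero, zero_add,
        iteratedDerivWithin_iteratedDerivWithin, h.leading]
      · simp; ring
      · intro j hj
        rw [iteratedDerivWithin_iteratedDerivWithin, h.lower _ (by simp at hj; omega), smul_zero]
    simp only [hsum, sub_zero] at hT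
    have h1 := hT.tendsto_div_nhds_zero.add_const (a / p ! : ℝ)
    have hval : (a * ((k + p).descFactorial k : ℕ) / (k + p)! : ℝ) = 0 + a / p ! := by
      have := Nat.factorial_mul_descFactorial (Nat.le_add_right k p)
      rw [Nat.add_sub_cancel_left] at this
      rw [← this]
      have h3 : ((k + p).descFactorial k : ℝ) ≠ 0 := by
        rw [Nat.cast_ne_zero, Ne, Nat.descFactorial_eq_zero_iff_lt]; omega
      have h4 : (p ! : ℝ) ≠ 0 := by positivity
      push_cast
      field_simp
      ring
    rw [hval]
    refine h1.congr' ?_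
    filter_upwards [self_mem_nhdsWithin] with t ht
    have ht : t ≠ 0 := (mem_Ioi.1 ht).ne'
    rw [pow_add]
    field_simp
    ring
  · rw [Nat.descFactorial_eq_zero_iff_lt.2 hkm]
    have hc : Tendsto (iteratedDerivWithin k u (Ico 0 1)) (𝓝[>] 0)
        (𝓝 (iteratedDerivWithin k u (Ico 0 1) 0)) :=
      (hk.continuousOn 0 h0).tendsto.mono_left hle
    have := (tendsto_pow_nhdsGT_zero (show k - m ≠ 0 by omega)).mul hc
    simp only [zero_mul] at this
    simp only [Nat.cast_zero, mul_zero, zero_div]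
    refine this.congr' ?_
    filter_upwards [self_mem_nhdsWithin] with t ht
    have ht : t ≠ 0 := (mem_Ioi.1 ht).ne'
    rw [pow_sub₀ _ ht hkm.le]
    field_simp

theorem VanishesToOrder.tendsto_div_pow {u : ℝ → ℝ} {m : ℕ} {a : ℝ}
    (h : VanishesToOrder u m a) (hu : ContDiffOn ℝ ∞ u (Ico 0 1)) :
    Tendsto (fun t => u t / t ^ m) (𝓝[>] 0) (𝓝 (a / m !)) := by
  simpa using h.tendsto_pow_mul_iteratedDerivWithin hu 0

theorem VanishesToOrder.tendsto_pow_mul_iteratedDerivWithin_div {u : ℝ → ℝ} {m : ℕ} {a : ℝ}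
    (h : VanishesToOrder u m a) (hu : ContDiffOn ℝ ∞ u (Ico 0 1)) (k : ℕ) :
    Tendsto (fun t => t ^ k * iteratedDerivWithin k u (Ico 0 1) t / u t) (𝓝[>] 0)
      (𝓝 (m.descFactorial k)) := by
  have ha := h.ne_zero
  have hm : (m ! : ℝ) ≠ 0 := by positivity
  have := (h.tendsto_pow_mul_iteratedDerivWithin hu k).div (h.tendsto_div_pow hu)
    (div_ne_zero ha hm)
  rw [show (a * m.descFactorial k / m ! / (a / m !) : ℝ) = m.descFactorial k by field_simp] at this
  refine this.congr' ?_
  filter_upwards [self_mem_nhdsWithin] with t ht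
  have ht : t ^ m ≠ 0 := pow_ne_zero _ (mem_Ioi.1 ht).ne'
  exact div_div_div_cancel_right₀ ht _ _

/-! ### The change of time between two solutions -/

/-- Two functions that leave `0` on the same side take the same values near `0`, up to a change
of time `σ`. -/
theorem exists_time_change {u₁ u₂ : ℝ → ℝ} {m l : ℕ} {a b : ℝ} (hm : m ≠ 0) (hl : l ≠ 0)
    (hu₁ : ContDiffOn ℝ ∞ u₁ (Ico 0 1)) (hu₂ : ContDiffOn ℝ ∞ u₂ (Ico 0 1))
    (ha : VanishesToOrder u₁ m a) (hb : VanishesToOrder u₂ l b) (hab : 0 < a * b) :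
    ∃ σ : ℝ → ℝ, Tendsto σ (𝓝[>] 0) (𝓝[>] 0) ∧ ∀ᶠ t in 𝓝[>] 0, u₁ (σ t) = u₂ t := by
  have ha0 := ha.ne_zero
  -- The factor `a` makes both functions positive, whatever the common sign of `a` and `b`.
  have h1 : ∀ᶠ s in 𝓝[>] (0 : ℝ), a ^ 2 / (2 * m !) * s ^ m < a * u₁ s := by
    have hlt : a ^ 2 / (2 * m !) < a * (a / m !) := by
      have h : 0 < a ^ 2 / (2 * m !) := by positivity
      have e : a * (a / m !) = 2 * (a ^ 2 / (2 * m !)) := by field_simp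
      linarith
    filter_upwards [((ha.tendsto_div_pow hu₁).const_mul a).eventually_const_lt hlt,
      self_mem_nhdsWithin] with s hs hs0
    have := pow_pos (mem_Ioi.1 hs0) m
    rwa [← mul_div_assoc, lt_div_iff₀ this] at hs
  obtain ⟨ε, hε, hεs⟩ := mem_nhdsGT_iff_exists_Ioo_subset.1 h1
  have hε : 0 < ε := hε
  obtain ⟨δ, hδ0, hδ⟩ : ∃ δ, 0 < δ ∧ δ < min ε 1 := exists_between (by simp [hε])
  have hδε := hδ.trans_le (min_le_left _ _)
  have hδ1 := hδ.trans_le (min_le_right _ _)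
  have hc : 0 < a ^ 2 / (2 * m !) := by positivity
  have hpos : ∀ s ∈ Ioc 0 δ, a ^ 2 / (2 * m !) * s ^ m < a * u₁ s := fun s hs =>
    hεs ⟨hs.1, hs.2.trans_lt hδε⟩
  have hu1 : 0 < a * u₁ δ :=
    (by positivity : 0 < a ^ 2 / (2 * m !) * δ ^ m).trans (hpos δ ⟨hδ0, le_rfl⟩)
  have h2 : Tendsto (fun t => a * u₂ t) (𝓝[>] 0) (𝓝 0) := by
    have := ((hb.tendsto_div_pow hu₂).mul (tendsto_pow_nhdsGT_zero hl)).const_mul a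
    simp only [mul_zero] at this
    refine this.congr' ?_
    filter_upwards [self_mem_nhdsWithin] with t ht
    have ht : t ^ l ≠ 0 := pow_ne_zero _ (mem_Ioi.1 ht).ne'
    rw [div_mul_cancel₀ _ ht]
  have h3 : ∀ᶠ t in 𝓝[>] (0 : ℝ), 0 < a * u₂ t := by
    have hlt : 0 < a * (b / l !) := by rw [← mul_div_assoc]; positivity
    filter_upwards [((hb.tendsto_div_pow hu₂).const_mul a).eventually_const_lt hlt,
      self_mem_nhdsWithin] with s hs hs0
    have := pow_pos (mem_Ioi.1 hs0) l
    rwa [← mul_div_assoc, lt_div_iff₀ this, zero_mul] at hs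
  have hu0 : u₁ 0 = 0 := by simpa using ha.lower 0 (Nat.pos_of_ne_zero hm)
  have hcont : ContinuousOn (fun s => a * u₁ s) (Icc 0 δ) :=
    continuousOn_const.mul (hu₁.continuousOn.mono fun s hs => ⟨hs.1, hs.2.trans_lt hδ1⟩)
  have hex : ∀ᶠ t in 𝓝[>] (0 : ℝ), ∃ s, s ∈ Ioo 0 δ ∧ a * u₁ s = a * u₂ t := by
    filter_upwards [h3, h2.eventually_lt_const hu1] with t ht ht'
    have := intermediate_value_Ioo hδ0.le hcont (show a * u₂ t ∈ Ioo _ _ by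
      simp only [hu0, mul_zero]; exact ⟨ht, ht'⟩)
    exact this
  obtain ⟨σ, hσ⟩ := hex.choice
  refine ⟨σ, tendsto_nhdsWithin_iff.2 ⟨?_, hσ.mono fun t ht => ht.1.1⟩,
    hσ.mono fun t ht => mul_left_cancel₀ ha0 ht.2⟩
  refine tendsto_order.2 ⟨fun e he => hσ.mono fun t ht => he.trans ht.1.1, fun e he => ?_⟩
  have hce : 0 < a ^ 2 / (2 * m !) * e ^ m := by positivity
  filter_upwards [hσ, h2.eventually_lt_const hce] with t ht ht'
  have := hpos (σ t) ⟨ht.1.1, ht.1.2.le⟩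
  rw [ht.2] at this
  exact lt_of_pow_lt_pow_left₀ m he.le (lt_of_mul_lt_mul_left (this.trans ht') hc.le)

/-- If the `n`-th derivatives of two functions correspond under a change of time that matches
their values, then the functions have the same leading term and the change of time is
asymptotically trivial. -/
theorem leading_term_eq_of_time_change {u₁ u₂ σ : ℝ → ℝ} {n m l : ℕ} {a b : ℝ} (hn : n ≠ 0)
    (hm : n ≤ m) (hl : n ≤ l)
    (hu₁ : ContDiffOn ℝ ∞ u₁ (Ico 0 1)) (hu₂ : ContDiffOn ℝ ∞ u₂ (Ico 0 1))
    (ha : VanishesToOrder u₁ m a) (hb : VanishesToOrder u₂ l b)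
    (hσ : Tendsto σ (𝓝[>] 0) (𝓝[>] 0)) (hval : ∀ᶠ t in 𝓝[>] 0, u₁ (σ t) = u₂ t)
    (hder : ∀ᶠ t in 𝓝[>] 0, iteratedDerivWithin n u₁ (Ico 0 1) (σ t) =
      iteratedDerivWithin n u₂ (Ico 0 1) t) :
    m = l ∧ a = b ∧ Tendsto (fun t => σ t / t) (𝓝[>] 0) (𝓝 1) := by
  have ha0 := ha.ne_zero
  have hb0 := hb.ne_zero
  have hσ0 : ∀ᶠ t in 𝓝[>] (0 : ℝ), 0 < σ t := hσ.eventually self_mem_nhdsWithin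
  have hdm : (0 : ℝ) < m.descFactorial n := by
    rw [Nat.cast_pos, Nat.pos_iff_ne_zero, Ne, Nat.descFactorial_eq_zero_iff_lt]; omega
  have hdl : (0 : ℝ) < l.descFactorial n := by
    rw [Nat.cast_pos, Nat.pos_iff_ne_zero, Ne, Nat.descFactorial_eq_zero_iff_lt]; omega
  have hne : ∀ᶠ t in 𝓝[>] (0 : ℝ), iteratedDerivWithin n u₂ (Ico 0 1) t / u₂ t ≠ 0 := by
    filter_upwards [(hb.tendsto_pow_mul_iteratedDerivWithin_div hu₂ n).eventually_const_lt hdl]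
      with t ht h0
    rw [mul_div_assoc, h0, mul_zero] at ht
    exact ht.false
  -- Dividing `tⁿ u⁽ⁿ⁾ / u` for the two functions leaves only the ratio of the times.
  have hpow : Tendsto (fun t => (σ t / t) ^ n) (𝓝[>] 0)
      (𝓝 (m.descFactorial n / l.descFactorial n)) := by
    refine (((ha.tendsto_pow_mul_iteratedDerivWithin_div hu₁ n).comp hσ).div
      (hb.tendsto_pow_mul_iteratedDerivWithin_div hu₂ n) hdl.ne').congr' ?_
    filter_upwards [hval, hder, hne] with t h1 h2 h3
    simp only [Function.comp, Pi.div_apply]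
    rw [h1, h2, mul_div_assoc, mul_div_assoc (t ^ n), mul_div_mul_right _ _ h3, div_pow]
  obtain ⟨c, hc0, hcn, hc⟩ : ∃ c : ℝ, 0 < c ∧ c ^ n = m.descFactorial n / l.descFactorial n ∧
      Tendsto (fun t => σ t / t) (𝓝[>] 0) (𝓝 c) := by
    refine ⟨(m.descFactorial n / l.descFactorial n : ℝ) ^ (n⁻¹ : ℝ), by positivity,
      Real.rpow_inv_natCast_pow (by positivity) hn, ?_⟩
    refine (hpow.rpow_const (Or.inr (by positivity))).congr' ?_
    filter_upwards [hσ0, self_mem_nhdsWithin] with t h1 h2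
    have h2 : 0 < t := h2
    exact Real.pow_rpow_inv_natCast (by positivity) hn
  -- Comparing the values determines the limit of `t ^ l / t ^ m`.
  have hlm : Tendsto (fun t : ℝ => t ^ l / t ^ m) (𝓝[>] 0)
      (𝓝 ((a / m !) / (b / l !) * c ^ m)) := by
    refine ((((ha.tendsto_div_pow hu₁).comp hσ).div (hb.tendsto_div_pow hu₂)
      (by positivity)).mul (hc.pow m)).congr' ?_
    have hne2 : ∀ᶠ t in 𝓝[>] (0 : ℝ), u₂ t ≠ 0 := hne.mono fun t ht h0 => ht (by simp [h0])
    filter_upwards [hval, hσ0, self_mem_nhdsWithin, hne2] with t h1 h2 h3 h4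
    have h3 : t ≠ 0 := (mem_Ioi.1 h3).ne'
    simp only [Function.comp, Pi.div_apply]
    rw [h1, div_pow]
    field_simp
  have hL : (a / m !) / (b / l !) * c ^ m ≠ 0 := by positivity
  have hml : m = l := by
    rcases lt_trichotomy m l with h | h | h
    · refine absurd (tendsto_nhds_unique ((tendsto_pow_nhdsGT_zero (show l - m ≠ 0 by omega)).congr' ?_) hlm) hL.symm
      filter_upwards [self_mem_nhdsWithin] with t ht
      rw [pow_sub₀ _ (mem_Ioi.1 ht).ne' h.le, div_eq_mul_inv]
    · exact h
    · refine absurd (tendsto_nhds_unique ((tendsto_pow_nhdsGT_zero (show m - l ≠ 0 by omega)).congr' ?_) (hlm.inv₀ hL))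
        (inv_ne_zero hL).symm
      filter_upwards [self_mem_nhdsWithin] with t ht
      rw [pow_sub₀ _ (mem_Ioi.1 ht).ne' h.le, inv_div, div_eq_mul_inv]
  subst hml
  rw [div_self hdm.ne'] at hcn
  have hc1 : c = 1 := (pow_eq_one_iff_of_nonneg hc0.le hn).1 hcn
  subst hc1
  refine ⟨rfl, ?_, hc⟩
  have h1 : Tendsto (fun t : ℝ => t ^ m / t ^ m) (𝓝[>] 0) (𝓝 1) := by
    refine tendsto_const_nhds.congr' ?_
    filter_upwards [self_mem_nhdsWithin] with t ht
    rw [div_self (pow_ne_zero _ (mem_Ioi.1 ht).ne')]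
  have h2 := tendsto_nhds_unique h1 hlm
  field_simp at h2
  rw [one_pow, mul_one] at h2
  exact h2.symm

/-! ### Uniqueness for the singular linear differential inequality -/

/-- Repeated integration from `0` of a bound by a monomial. -/
theorem abs_le_mul_pow_of_abs_iteratedDerivWithin_le {w : ℝ → ℝ} {δ C : ℝ} (hδ : δ ≤ 1)
    (hw : ContDiffOn ℝ ∞ w (Ico 0 1)) (n p : ℕ)
    (h0 : ∀ k < n, iteratedDerivWithin k w (Ico 0 1) 0 = 0)
    (hb : ∀ t ∈ Ico 0 δ, |iteratedDerivWithin n w (Ico 0 1) t| ≤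
      C * (p + n).descFactorial n * t ^ p) :
    ∀ t ∈ Ico 0 δ, |w t| ≤ C * t ^ (p + n) := by
  induction n generalizing p with
  | zero => simpa using hb
  | succ n ih =>
    have hs : UniqueDiffOn ℝ (Ico (0 : ℝ) 1) := uniqueDiffOn_Ico 0 1
    rw [show p + (n + 1) = p + 1 + n by ring] at hb ⊢
    refine ih (p + 1) (fun k hk => h0 k (by omega)) fun t ht => ?_
    have hcoef : ((p + 1 + n).descFactorial (n + 1) : ℝ) =
        (p + 1) * (p + 1 + n).descFactorial n := by
      rw [Nat.descFactorial_succ, Nat.add_sub_cancel]; push_cast; ring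
    refine image_norm_le_of_norm_deriv_right_le_deriv_boundary (a := 0) (b := t)
      (f := iteratedDerivWithin n w (Ico 0 1))
      (f' := iteratedDerivWithin (n + 1) w (Ico 0 1))
      (B := fun t => C * (p + 1 + n).descFactorial n * t ^ (p + 1))
      (B' := fun t => C * (p + 1 + n).descFactorial (n + 1) * t ^ p) ?_ ?_ ?_ ?_ ?_ ⟨ht.1, le_rfl⟩
    · exact (hw.iteratedDerivWithin_infty hs n).continuousOn.mono fun x hx =>
        ⟨hx.1, hx.2.trans_lt (ht.2.trans_le hδ)⟩
    · intro x hx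
      have hx1 : x < 1 := hx.2.trans (ht.2.trans_le hδ)
      refine (hw.hasDerivWithinAt_iteratedDerivWithin hs n ⟨hx.1, hx1⟩).mono_of_mem_nhdsWithin ?_
      exact mem_of_superset (Ico_mem_nhdsGE hx1) (Ico_subset_Ico_left hx.1)
    · simp [h0 n (by omega)]
    · intro x
      refine ((hasDerivAt_pow (p + 1) x).const_mul _).congr_deriv ?_
      rw [hcoef, Nat.add_sub_cancel]; push_cast; ring
    · intro x hx
      exact hb x ⟨hx.1, hx.2.trans ht.2⟩

/-- The constant `m.descFactorial n` is the one for which `tᵐ` is a solution of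
`tⁿ w⁽ⁿ⁾ = K w`; for a smaller constant, integrating the inequality contracts the best constant
in `|w| ≤ M tᵐ`. -/
theorem eq_zero_of_abs_iteratedDerivWithin_le {w : ℝ → ℝ} {n m : ℕ} {δ K : ℝ} (hnm : n ≤ m)
    (hδ : δ ≤ 1) (hw : ContDiffOn ℝ ∞ w (Ico 0 1)) (hK0 : 0 ≤ K) (hK : K < m.descFactorial n)
    (h0 : ∀ k ≤ n, iteratedDerivWithin k w (Ico 0 1) 0 = 0)
    (hb : ∀ t ∈ Ioo 0 δ, t ^ n * |iteratedDerivWithin n w (Ico 0 1) t| ≤ K * |w t|)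
    (hM : ∀ t ∈ Ico 0 δ, |w t| ≤ t ^ m) :
    ∀ t ∈ Ico 0 δ, w t = 0 := by
  obtain ⟨p, rfl⟩ := Nat.exists_eq_add_of_le' hnm
  set D : ℝ := (Nat.descFactorial (p + n) n : ℝ) with hD
  have hD0 : 0 < D := hK0.trans_lt hK
  have key : ∀ j : ℕ, ∀ t ∈ Ico 0 δ, |w t| ≤ (K / D) ^ j * t ^ (p + n) := by
    intro j
    induction j with
    | zero => simpa using hM
    | succ j ih =>
      refine abs_le_mul_pow_of_abs_iteratedDerivWithin_le hδ hw n p (fun k hk => h0 k hk.le) ?_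
      intro t ht
      rw [← hD]
      rcases ht.1.eq_or_lt with rfl | ht0
      · rw [h0 n le_rfl, abs_zero]; positivity
      · have h1 := hb t ⟨ht0, ht.2⟩
        have h2 := mul_le_mul_of_nonneg_left (ih t ht) hK0
        have h3 : t ^ n * |iteratedDerivWithin n w (Ico 0 1) t| ≤
            t ^ n * ((K / D) ^ (j + 1) * D * t ^ p) := by
          refine (h1.trans h2).trans_eq ?_
          rw [pow_succ, pow_add]
          field_simp
        exact le_of_mul_le_mul_left h3 (by positivity)
  intro t ht
  have hlim : Tendsto (fun j : ℕ => (K / D) ^ j * t ^ (p + n)) atTop (𝓝 (0 * t ^ (p + n))) :=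
    (tendsto_pow_atTop_nhds_zero_of_lt_one (by positivity) ((div_lt_one hD0).2 hK)).mul_const _
  rw [zero_mul] at hlim
  exact abs_nonpos_iff.1 (ge_of_tendsto' hlim fun j => key j t ht)

/-- The singular linear inequality satisfied by the difference of the two functions. The constant
`m.descFactorial (n + 1) / m` is the limit of `tⁿ u₁⁽ⁿ⁺¹⁾ / u₁'`, where `u₁⁽ⁿ⁺¹⁾ / u₁'` is the
derivative of the function taking `u₁` to `u₁⁽ⁿ⁾`; so no regularity of that function has to be
assumed. -/
theorem eventually_pow_mul_abs_iteratedDerivWithin_sub_le {u₁ u₂ σ : ℝ → ℝ} {n m : ℕ} {a K : ℝ}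
    (hm : m ≠ 0) (hu₁ : ContDiffOn ℝ ∞ u₁ (Ico 0 1)) (ha : VanishesToOrder u₁ m a)
    (hσ : Tendsto σ (𝓝[>] 0) (𝓝[>] 0)) (hσ1 : Tendsto (fun t => σ t / t) (𝓝[>] 0) (𝓝 1))
    (hval : ∀ᶠ t in 𝓝[>] 0, u₁ (σ t) = u₂ t)
    (hder : ∀ᶠ t in 𝓝[>] 0, iteratedDerivWithin n u₁ (Ico 0 1) (σ t) =
      iteratedDerivWithin n u₂ (Ico 0 1) t)
    (hK : m.descFactorial (n + 1) / m < K) :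
    ∀ᶠ t in 𝓝[>] 0, t ^ n * |iteratedDerivWithin n u₁ (Ico 0 1) t -
      iteratedDerivWithin n u₂ (Ico 0 1) t| ≤ K * |u₁ t - u₂ t| := by
  have hs : UniqueDiffOn ℝ (Ico (0 : ℝ) 1) := uniqueDiffOn_Ico 0 1
  have hm0 : (0 : ℝ) < m := by positivity
  have hmvt : ∀ x y, 0 < x → x < y → y < 1 → ∃ ξ ∈ Icc x y,
      (iteratedDerivWithin n u₁ (Ico 0 1) y - iteratedDerivWithin n u₁ (Ico 0 1) x) *
        iteratedDerivWithin 1 u₁ (Ico 0 1) ξ =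
      (u₁ y - u₁ x) * iteratedDerivWithin (n + 1) u₁ (Ico 0 1) ξ := by
    intro x y hx hxy hy
    have hsub : Icc x y ⊆ Ico 0 1 := fun z hz => ⟨hx.le.trans hz.1, hz.2.trans_lt hy⟩
    have hd : ∀ k, ∀ z ∈ Ioo x y, HasDerivAt (iteratedDerivWithin k u₁ (Ico 0 1))
        (iteratedDerivWithin (k + 1) u₁ (Ico 0 1) z) z := fun k z hz =>
      (hu₁.hasDerivWithinAt_iteratedDerivWithin hs k (hsub (Ioo_subset_Icc_self hz))).hasDerivAt
        (Ico_mem_nhds (hx.trans hz.1) (hz.2.trans hy))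
    have h0 := hd 0
    rw [iteratedDerivWithin_zero] at h0
    obtain ⟨ξ, hξ, h⟩ := exists_ratio_hasDerivAt_eq_ratio_slope u₁
      (iteratedDerivWithin 1 u₁ (Ico 0 1)) hxy (hu₁.continuousOn.mono hsub) h0
      (iteratedDerivWithin n u₁ (Ico 0 1)) (iteratedDerivWithin (n + 1) u₁ (Ico 0 1))
      ((hu₁.iteratedDerivWithin_infty hs n).continuousOn.mono hsub) (hd n)
    exact ⟨ξ, Ioo_subset_Icc_self hξ, h⟩
  have hIoo : Ioo (0 : ℝ) 1 ∈ 𝓝[>] (0 : ℝ) := Ioo_mem_nhdsGT one_pos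
  have hex : ∀ᶠ t in 𝓝[>] (0 : ℝ), ∃ ξ, ξ ∈ Icc (min t (σ t)) (max t (σ t)) ∧
      (iteratedDerivWithin n u₁ (Ico 0 1) t - iteratedDerivWithin n u₂ (Ico 0 1) t) *
        iteratedDerivWithin 1 u₁ (Ico 0 1) ξ =
      (u₁ t - u₂ t) * iteratedDerivWithin (n + 1) u₁ (Ico 0 1) ξ := by
    filter_upwards [hval, hder, hIoo, hσ.eventually hIoo] with t h1 h2 h3 h4
    rw [← h1, ← h2]
    rcases lt_trichotomy t (σ t) with h | h | h
    · obtain ⟨ξ, hξ, e⟩ := hmvt t (σ t) h3.1 h h4.2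
      rw [min_eq_left h.le, max_eq_right h.le]
      exact ⟨ξ, hξ, by linear_combination -e⟩
    · exact ⟨t, by simp, by simp [← h]⟩
    · obtain ⟨ξ, hξ, e⟩ := hmvt (σ t) t h4.1 h h3.2
      rw [min_eq_right h.le, max_eq_left h.le]
      exact ⟨ξ, hξ, e⟩
  obtain ⟨ξ, hξ⟩ := hex.choice
  have hξ1 : Tendsto (fun t => ξ t / t) (𝓝[>] 0) (𝓝 1) := by
    have hlo : Tendsto (fun t => min 1 (σ t / t)) (𝓝[>] 0) (𝓝 1) := by
      simpa using (tendsto_const_nhds (x := (1 : ℝ))).min hσ1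
    have hhi : Tendsto (fun t => max 1 (σ t / t)) (𝓝[>] 0) (𝓝 1) := by
      simpa using (tendsto_const_nhds (x := (1 : ℝ))).max hσ1
    refine tendsto_of_tendsto_of_tendsto_of_le_of_le' hlo hhi ?_ ?_
    · filter_upwards [hξ, self_mem_nhdsWithin] with t h ht
      have ht : 0 < t := ht
      rw [← div_self ht.ne', min_div_div_right ht.le]
      gcongr
      exact h.1.1
    · filter_upwards [hξ, self_mem_nhdsWithin] with t h ht
      have ht : 0 < t := ht
      rw [← div_self ht.ne', max_div_div_right ht.le]
      gcongr
      exact h.1.2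
  have hξ0 : Tendsto ξ (𝓝[>] 0) (𝓝[>] 0) := by
    refine tendsto_nhdsWithin_iff.2 ⟨?_, ?_⟩
    · have := hξ1.mul (tendsto_id.mono_left (nhdsWithin_le_nhds (s := Ioi (0 : ℝ))))
      rw [mul_zero] at this
      refine this.congr' ?_
      filter_upwards [self_mem_nhdsWithin] with t ht
      exact div_mul_cancel₀ _ (mem_Ioi.1 ht).ne'
    · filter_upwards [hξ, self_mem_nhdsWithin, hσ.eventually self_mem_nhdsWithin] with t h h1 h2
      exact (lt_min h1 h2).trans_le h.1.1
  have hA := (ha.tendsto_pow_mul_iteratedDerivWithin_div hu₁ (n + 1)).comp hξ0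
  have hB := (ha.tendsto_pow_mul_iteratedDerivWithin_div hu₁ 1).comp hξ0
  rw [Nat.descFactorial_one] at hB
  have hne : ∀ᶠ t in 𝓝[>] (0 : ℝ), iteratedDerivWithin 1 u₁ (Ico 0 1) (ξ t) ≠ 0 ∧
      u₁ (ξ t) ≠ 0 := by
    filter_upwards [hB.eventually_const_lt hm0] with t ht
    constructor <;> intro h <;> simp only [Function.comp, h, mul_zero, zero_div, div_zero, lt_irrefl] at ht
  have hR : Tendsto (fun t => t ^ n * |iteratedDerivWithin (n + 1) u₁ (Ico 0 1) (ξ t)| /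
      |iteratedDerivWithin 1 u₁ (Ico 0 1) (ξ t)|) (𝓝[>] 0)
      (𝓝 |m.descFactorial (n + 1) / m / 1 ^ n|) := by
    refine ((hA.div hB hm0.ne').div (hξ1.pow n) (by simp)).abs.congr' ?_
    filter_upwards [hne, self_mem_nhdsWithin, hξ0.eventually self_mem_nhdsWithin] with t h h1 h2
    obtain ⟨h3, h4⟩ := h
    have h1 : 0 < t := h1
    have h2 : 0 < ξ t := h2
    simp only [Function.comp, Pi.div_apply]
    rw [← abs_of_pos (pow_pos h1 n), ← abs_mul, ← abs_div, div_pow]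
    congr 1
    field_simp
    ring
  rw [one_pow, div_one, abs_of_nonneg (by positivity)] at hR
  filter_upwards [hR.eventually_lt_const hK, hξ, hne] with t h1 h2 h3
  have hpos := abs_pos.2 h3.1
  rw [div_lt_iff₀ hpos] at h1
  have h4 := congrArg abs h2.2
  rw [abs_mul, abs_mul] at h4
  refine le_of_mul_le_mul_right ?_ hpos
  rw [mul_assoc, h4, mul_left_comm, mul_right_comm, mul_comm _ |u₁ t - u₂ t|]
  exact mul_le_mul_of_nonneg_left h1.le (abs_nonneg _)

/-! ### Solutions of the autonomous equation -/

/-- At `t = 0` the equation gives `f 0 = u⁽ⁿ⁾(0)`, so `m = n` exactly when `f 0 ≠ 0`, and then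
`f 0` is the leading coefficient of both solutions. -/
theorem leading_coeff_mul_pos {n m l : ℕ} {f u₁ u₂ : ℝ → ℝ} {a b : ℝ} (hn : 1 ≤ n) (hm : n ≤ m)
    (hl : n ≤ l) (hu₁ : IsSmoothSolution n f u₁) (hu₂ : IsSmoothSolution n f u₂)
    (ha : VanishesToOrder u₁ m a) (hb : VanishesToOrder u₂ l b)
    (hab : n < m → n < l → 0 < a * b) : 0 < a * b := by
  have h0 : (0 : ℝ) ∈ Ico (0 : ℝ) 1 := by simp
  have h1 : u₁ 0 = 0 := by simpa using ha.lower 0 (by omega)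
  have h2 : u₂ 0 = 0 := by simpa using hb.lower 0 (by omega)
  have e : iteratedDerivWithin n u₁ (Ico 0 1) 0 = iteratedDerivWithin n u₂ (Ico 0 1) 0 := by
    rw [hu₁.eqn 0 h0, hu₂.eqn 0 h0, h1, h2]
  rcases hm.eq_or_lt with rfl | hm
  · rcases hl.eq_or_lt with rfl | hl
    · rw [ha.leading, hb.leading] at e
      rw [← e]
      exact mul_self_pos.2 ha.ne_zero
    · rw [ha.leading, hb.lower n hl] at e
      exact absurd e ha.ne_zero
  · rcases hl.eq_or_lt with rfl | hl
    · rw [hb.leading, ha.lower n hm] at e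
      exact absurd e.symm hb.ne_zero
    · exact hab hm hl

theorem theorem3 (n m l : ℕ) (hn : 1 ≤ n) (hm : n ≤ m) (hl : n ≤ l)
    (f u₁ u₂ : ℝ → ℝ) (a b : ℝ)
    (hu₁ : IsSmoothSolution n f u₁) (hu₂ : IsSmoothSolution n f u₂)
    (ha : VanishesToOrder u₁ m a) (hb : VanishesToOrder u₂ l b)
    (hab : n < m → n < l → 0 < a * b) :
    m = l ∧ a = b ∧
      ∃ δ : ℝ, 0 < δ ∧ δ ≤ 1 ∧ ∀ t ∈ Set.Ico (0 : ℝ) δ, u₁ t = u₂ t := by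
  obtain ⟨σ, hσ, hval⟩ := exists_time_change (by omega) (by omega) hu₁.smooth hu₂.smooth ha hb
    (leading_coeff_mul_pos hn hm hl hu₁ hu₂ ha hb hab)
  have hIoo : Ioo (0 : ℝ) 1 ∈ 𝓝[>] (0 : ℝ) := Ioo_mem_nhdsGT one_pos
  -- Both sides are the value of `f` at the common point `u₁ (σ t) = u₂ t`.
  have hder : ∀ᶠ t in 𝓝[>] 0, iteratedDerivWithin n u₁ (Ico 0 1) (σ t) =
      iteratedDerivWithin n u₂ (Ico 0 1) t := by
    filter_upwards [hval, hIoo, hσ.eventually hIoo] with t h1 h2 h3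
    rw [hu₁.eqn _ (Ioo_subset_Ico_self h3), hu₂.eqn _ (Ioo_subset_Ico_self h2), h1]
  obtain ⟨rfl, rfl, hσ1⟩ := leading_term_eq_of_time_change (by omega) hm hl hu₁.smooth hu₂.smooth
    ha hb hσ hval hder
  refine ⟨rfl, rfl, ?_⟩
  have hm0 : (0 : ℝ) < m := by exact_mod_cast (by omega : 0 < m)
  -- The two constants differ by the factor `(m - n) / m`, which is less than `1` as `1 ≤ n`.
  have hgap : (m.descFactorial (n + 1) / m : ℝ) < m.descFactorial n := by
    have hd : 0 < m.descFactorial n := by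
      rw [Nat.pos_iff_ne_zero, Ne, Nat.descFactorial_eq_zero_iff_lt]; omega
    rw [div_lt_iff₀ hm0, Nat.descFactorial_succ, mul_comm]
    exact_mod_cast Nat.mul_lt_mul_of_pos_left (by omega : m - n < m) hd
  obtain ⟨K, hK1, hK2⟩ := exists_between hgap
  have hK0 : 0 ≤ K := (by positivity : (0 : ℝ) ≤ m.descFactorial (n + 1) / m).trans hK1.le
  have hlin := eventually_pow_mul_abs_iteratedDerivWithin_sub_le (by omega) hu₁.smooth ha hσ hσ1
    hval hder hK1
  have hsmall : ∀ᶠ t in 𝓝[>] (0 : ℝ), |u₁ t - u₂ t| < t ^ m := by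
    have h := ((ha.tendsto_div_pow hu₁.smooth).sub (hb.tendsto_div_pow hu₂.smooth)).abs
    rw [sub_self, abs_zero] at h
    filter_upwards [h.eventually_lt_const one_pos, self_mem_nhdsWithin] with t h1 h2
    have h2 : 0 < t ^ m := pow_pos (mem_Ioi.1 h2) m
    rwa [← sub_div, abs_div, abs_of_pos h2, div_lt_one h2] at h1
  obtain ⟨ε, hε, hεs⟩ := mem_nhdsGT_iff_exists_Ioo_subset.1 (hlin.and hsmall)
  have hε : 0 < ε := hε
  have hsub : ∀ k, ∀ t ∈ Ico (0 : ℝ) 1, iteratedDerivWithin k (u₁ - u₂) (Ico 0 1) t =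
      iteratedDerivWithin k u₁ (Ico 0 1) t - iteratedDerivWithin k u₂ (Ico 0 1) t :=
    fun k t ht => iteratedDerivWithin_sub ht (uniqueDiffOn_Ico 0 1)
      ((hu₁.smooth t ht).of_le (mod_cast le_top)) ((hu₂.smooth t ht).of_le (mod_cast le_top))
  have h0 : (0 : ℝ) ∈ Ico (0 : ℝ) 1 := by simp
  have hw0 : ∀ k ≤ m, iteratedDerivWithin k (u₁ - u₂) (Ico 0 1) 0 = 0 := by
    intro k hk
    rw [hsub k 0 h0]
    rcases hk.eq_or_lt with rfl | hk
    · rw [ha.leading, hb.leading, sub_self]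
    · rw [ha.lower k hk, hb.lower k hk, sub_self]
  refine ⟨min ε 1, by positivity, min_le_right _ _, fun t ht => sub_eq_zero.1 ?_⟩
  refine eq_zero_of_abs_iteratedDerivWithin_le (w := u₁ - u₂) hm (min_le_right ε 1)
    (hu₁.smooth.sub hu₂.smooth) hK0 hK2 (fun k hk => hw0 k (hk.trans hm)) ?_ ?_ t ht
  · intro t ht
    rw [hsub n t ⟨ht.1.le, ht.2.trans_le (min_le_right _ _)⟩]
    exact (hεs ⟨ht.1, ht.2.trans_le (min_le_left _ _)⟩).1
  · intro t ht
    rcases ht.1.eq_or_lt with rfl | ht0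
    · have := hw0 0 (Nat.zero_le m)
      rw [iteratedDerivWithin_zero] at this
      rw [this, abs_zero]
      exact pow_nonneg le_rfl m
    · exact (hεs ⟨ht0, ht.2.trans_le (min_le_left _ _)⟩).2.le

end
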